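/- Let $\nu$ be a probability measure on $\mathbb{R}^d$ with compact support and $\operatorname{Diam}(\operatorname{Supp}\nu)\le R$ for some $R>0$, let $0<\delta<1$, and put $\sigma^2:=1-(1-\delta)^2$. For $s\in(0,1]$ let $$\bar p_s(x)=\int (2\pi s(2-s))^{-d/2}\exp\!\Big(-\frac{|x-(1-s)y|^2}{2s(2-s)}\Big)\,\nu(\mathrm{d}y)$$ be the time-$s$ marginal density of the forward diffusion $\mathrm{d}X_s=-\frac{1}{1-s}X_s\,\mathrm{d}s+\sqrt{\frac{2}{1-s}}\,\mathrm{d}W_s$, $X_0\sim\nu$ (base covariance $C=I_d$; for $s=1$ the standard Gaussian density), let $p_t:=\bar p_{1-t}$, and let the Föllmer velocity be $V(t,x)=\frac1t\,[x+\nabla\log p_t(x)]$ for $t\in(0,1)$ and $V(0,x)=\mathbb{E}_\nu[X]$. Take $A=\sigma^2 I_d$ and let $h$ be the corresponding Gaussian-tail remainder at the early stopping time, $\bar p_\delta(x)=\exp(-|x|^2/(2\sigma^2))\exp(h(x))$. Put $H:=\sup_x\|\nabla^2h(x)\|$, with the operator norm, and $a:=\max\{0,\,1-\tfrac1{2H}\}$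 ($a:=0$ if $H=0$), and define $$C_1^*=\max\Big\{\tfrac{\sigma^2|(1-\delta)^2a-1|}{(1+(1-\delta)^2a)^2},\ \tfrac{1+(1-\delta)^2}{\sigma^2},\ \tfrac{\sigma^2}{8}\Big\},\qquad C_2^*=\max\Big\{2,\ \tfrac{2\sigma^4\sqrt a}{(1+(1-\delta)^2a)^2},\ \tfrac{9\sigma^4}{8\sqrt3(1-\delta)}\Big\},$$ $$K_0^*=\tfrac{R}{\sigma^2},\quad K_1^*=\tfrac{3R^2}{\sigma^4},\quad K_2^*=\tfrac1{\sigma^2},\quad K_5^*=\tfrac{9C_1^*R^2}{\sigma^4}+\tfrac{2}{\sigma^4}+\tfrac1{\sigma^2},\quad K_6^*=\tfrac{6C_2^*R^2}{\sigma^4},\quad K_7^*=\tfrac{6(\sqrt3+1)R^3}{\sigma^6}C_2^*+\tfrac{2R}{\sigma^4}.$$ Then for all $t\in[0,1-\delta]$ and $x\in\mathbb{R}^d$, $V$ is differentiable in $x$ and in $t$ (from the right at $t=0$), and $$\|\nabla V(t,x)\|\le (K_1^*+K_2^*)\,t .$$ If moreover $\operatorname{Supp}\nu$ is contained in the closed ball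 of radius $R$ about the origin (for instance, if $0\in\operatorname{Supp}\nu$ or $\mathbb{E}_\nu[X]=0$), then for all $t\in[0,1-\delta]$ and $x\in\mathbb{R}^d$, $$|V(t,x)|\le K_0^*+K_2^*\,t\,|x|,\qquad |\partial_tV(t,x)|\le K_5^*|x|+\frac{K_6^*}{\sqrt{1-t^2}}+K_7^* .$$ -/

import Mathlib

open MeasureTheory

namespace Follmer

noncomputable section

/-- The data space `ℝᵈ` with its Euclidean norm. -/
abbrev Space (d : ℕ) : Type := EuclideanSpace ℝ (Fin d)

/-- The density at `x` of the Gaussian `N(m, v I_d)` on `ℝᵈ` (for `v > 0`). -/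
def gaussianDensity {d : ℕ} (m : Space d) (v : ℝ) (x : Space d) : ℝ :=
  (2 * Real.pi * v) ^ (-(d : ℝ) / 2) * Real.exp (-‖x - m‖ ^ 2 / (2 * v))

/-- The marginal density at time `s ∈ (0, 1]` of the forward diffusion
`dX_s = -X_s / (1 - s) ds + √(2 / (1 - s)) dW_s`, `X_0 ∼ ν` (base covariance `C = I_d`):
given `X_0 = y`, the law of `X_s` is `N((1 - s) y, s (2 - s) I_d)`. -/
def forwardDensity {d : ℕ} (ν : Measure (Space d)) (s : ℝ) (x : Space d) : ℝ :=
  ∫ y, gaussianDensity ((1 - s) • y) (s * (2 - s)) x ∂ν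

/-- The score `S(t, x) = ∇ log p_t (x)`, where `p_t` is the forward density at time `1 - t`. -/
def score {d : ℕ} (ν : Measure (Space d)) (t : ℝ) (x : Space d) : Space d :=
  gradient (fun z => Real.log (forwardDensity ν (1 - t) z)) x

/-- The Föllmer velocity field with base covariance `C = I_d`:
`V(t, x) = (x + S(t, x)) / t` for `t ≠ 0` and `V(0, x) = 𝔼_ν[X]`. -/
def velocity {d : ℕ} (ν : Measure (Space d)) (t : ℝ) (x : Space d) : Space d :=
  if t = 0 then ∫ y, y ∂ν else (1 / t) • (x + score ν t x)

/-- `σ² = 1 - (1 - δ)²`, so that `A = σ² I_d`. -/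
def sigmaSq (δ : ℝ) : ℝ := 1 - (1 - δ) ^ 2

/-- The remainder `h` of the Gaussian tail decomposition, with `A = (1 - (1 - δ)²) I_d`, of the
forward density at the early stopping time `δ`:
`p(x) = exp (-⟨x, A⁻¹ x⟩ / 2) * exp (h x)`. -/
def tailRemainder {d : ℕ} (ν : Measure (Space d)) (δ : ℝ) (x : Space d) : ℝ :=
  Real.log (forwardDensity ν δ x) + ‖x‖ ^ 2 / (2 * sigmaSq δ)

/-- `‖∇² h‖_∞`: the supremum over `x` of the operator norm of the Hessian of `h`. -/
def hessianSup {d : ℕ} (ν : Measure (Space d)) (δ : ℝ) : ℝ :=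
  ⨆ x : Space d, ‖fderiv ℝ (gradient (tailRemainder ν δ)) x‖

/-- The number `1 - 1 / (2 H)`, the square of the left end point of the range of times
`t ∈ [0, 1)` with `1 - t² ≤ 1 / (2 H)`; for `H ≤ 1 / 2` this range is all of `[0, 1)`,
and the number is `0`. -/
def cutoff (H : ℝ) : ℝ := if H ≤ 1 / 2 then 0 else 1 - 1 / (2 * H)

def C1 (δ H : ℝ) : ℝ :=
  max (max
    (sigmaSq δ * |(1 - δ) ^ 2 * cutoff H - 1| / |1 + (1 - δ) ^ 2 * cutoff H| ^ 2)
    (|-(1 - δ) ^ 2 - 1| / |sigmaSq δ|))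
    (|sigmaSq δ| / 8)

def C2 (δ H : ℝ) : ℝ :=
  max (max
    2
    (2 * sigmaSq δ ^ 2 * Real.sqrt (cutoff H) / |1 + (1 - δ) ^ 2 * cutoff H| ^ 2))
    (9 * sigmaSq δ ^ 2 / (8 * Real.sqrt 3 * (1 - δ)))

def K0 (R δ : ℝ) : ℝ := R / sigmaSq δ

def K1 (R δ : ℝ) : ℝ := 3 * (R / sigmaSq δ) ^ 2

def K2 (δ : ℝ) : ℝ := 1 / sigmaSq δ

def K5 (R δ H : ℝ) : ℝ :=
  9 * C1 δ H * R ^ 2 / sigmaSq δ ^ 2 + 2 / sigmaSq δ ^ 2 + 1 / sigmaSq δ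

def K6 (R δ H : ℝ) : ℝ := 6 * C2 δ H * R ^ 2 / sigmaSq δ ^ 2

def K7 (R δ H : ℝ) : ℝ :=
  6 * (Real.sqrt 3 + 1) * (R / sigmaSq δ) ^ 3 * C2 δ H + 2 * R / sigmaSq δ ^ 2

end

end Follmer

/-!
Put `v = 1 - t²`. Expanding the square in the Gaussian kernel,
`-‖x - t y‖² / (2 v) = -‖x‖² / (2 v) + ⟪y, (t / v) x⟫ - (t² / (2 v)) ‖y‖²`,
shows that `p_t (x)` is a Gaussian factor in `x` times the normalizing constant of the exponential
family obtained by tilting `ν` with the sufficient statistic `(y, ‖y‖²)` at the natural parameter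
`((t / v) x, -t² / (2 v))`. The tilted measure is the conditional law of the data point `Y ∼ ν`
given the position `x` at time `t`; write `m(t, x)` for its mean. Differentiating the logarithm
(`score_eq`) gives `V(t, x) = (m(t, x) - t x) / v` (`velocity_eq`), a formula that is regular at
`t = 0` and agrees there with `𝔼_ν[X]`.

In an exponential family the derivative of the mean in the natural parameter is the covariance of
the sufficient statistic with `Y` (`hasFDerivAt_integral_tilted`). By the chain rule
* `∇V = (t Cov(Y, Y) / v - t I) / v`;
* `∂ₜV = (∂ₜm - x) / v + (2 t / v²) (m - t x)`, with
  `∂ₜm = ((1 + t²) / v²) Cov(Y, Y) x - (t / v²) Cov(Y, ‖Y‖²)`.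

The diameter bound gives `‖Y - m‖ ≤ R`, hence `‖Cov(Y, Y)‖ ≤ R²`; if the support lies in the ball
of radius `R`, also `‖m‖ ≤ R` and `‖Cov(Y, ‖Y‖²)‖ ≤ R³`. All bounds follow from these and from
`v ≥ σ²`. The constants enter only through `C₁ ≥ (1 + (1 - δ)²) / σ²` and `C₂ ≥ 2`, which hold for
every value of `H`.
-/

open Filter Topology
open scoped RealInnerProductSpace

namespace Follmer

/-! ### Exponential tilting of compactly supported measures -/

section Tilting

variable {E : Type*} [NormedAddCommGroup E] [MeasurableSpace E] [BorelSpace E]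
  [SecondCountableTopology E] {μ : Measure E} {K : Set E}

lemma integrable_of_continuous_of_ae_mem_compact {G : Type*} [NormedAddCommGroup G]
    [IsFiniteMeasure μ] (hK : IsCompact K) (hμ : ∀ᵐ y ∂μ, y ∈ K) {f : E → G}
    (hf : Continuous f) : Integrable f μ := by
  obtain ⟨C, hC⟩ := hK.exists_bound_of_continuousOn hf.continuousOn
  exact Integrable.of_bound hf.aestronglyMeasurable C (hμ.mono fun y hy => hC y hy)

/-- Differentiation under the integral sign in a (vector-valued) Laplace transform; the integrand
is dominated because the measure has compact support. -/
lemma hasFDerivAt_integral_exp_smul {W G : Type*} [NormedAddCommGroup W] [NormedSpace ℝ W]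
    [NormedAddCommGroup G] [NormedSpace ℝ G] [CompleteSpace G]
    [IsFiniteMeasure μ] (hK : IsCompact K) (hμ : ∀ᵐ y ∂μ, y ∈ K)
    {T : E → W →L[ℝ] ℝ} (hT : Continuous T) {g : E → G} (hg : Continuous g) (θ : W) :
    HasFDerivAt (fun η => ∫ y, Real.exp (T y η) • g y ∂μ)
      (∫ y, Real.exp (T y θ) • (T y).smulRight (g y) ∂μ) θ := by
  obtain ⟨A, hA⟩ := hK.exists_bound_of_continuousOn hT.continuousOn
  obtain ⟨B, hB⟩ := hK.exists_bound_of_continuousOn hg.continuousOn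
  have hTη : ∀ η, Continuous fun y => T y η := fun η => hT.clm_apply continuous_const
  have hsmul : Continuous fun y => (T y).smulRight (g y) :=
    (ContinuousLinearMap.smulRightL ℝ W G).continuous₂.comp (hT.prodMk hg)
  refine hasFDerivAt_integral_of_dominated_of_fderiv_le
    (F' := fun η y => Real.exp (T y η) • (T y).smulRight (g y))
    (bound := fun _ => Real.exp (A * (‖θ‖ + 1)) * (A * B)) (Metric.ball_mem_nhds θ one_pos)
    ?_ ?_ ?_ ?_ (integrable_const _) ?_
  · exact Eventually.of_forall fun η =>
      ((Real.continuous_exp.comp (hTη η)).smul hg).aestronglyMeasurable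
  · exact integrable_of_continuous_of_ae_mem_compact hK hμ
      ((Real.continuous_exp.comp (hTη θ)).smul hg)
  · exact ((Real.continuous_exp.comp (hTη θ)).smul hsmul).aestronglyMeasurable
  · filter_upwards [hμ] with y hy η hη
    have hη' : ‖η‖ ≤ ‖θ‖ + 1 := by
      have h1 := norm_le_norm_add_norm_sub' η θ
      have h2 : ‖η - θ‖ < 1 := by simpa [dist_eq_norm] using hη
      linarith
    have hA0 : 0 ≤ A := (norm_nonneg _).trans (hA y hy)
    rw [norm_smul, Real.norm_eq_abs, Real.abs_exp, ContinuousLinearMap.norm_smulRight_apply]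
    gcongr
    · calc T y η ≤ ‖T y η‖ := Real.le_norm_self _
        _ ≤ ‖T y‖ * ‖η‖ := (T y).le_opNorm η
        _ ≤ A * (‖θ‖ + 1) := by gcongr; exact hA y hy
    · exact hA y hy
    · exact hB y hy
  · refine Eventually.of_forall fun y η _ => ?_
    convert! ((T y).hasFDerivAt (x := η)).exp.smul_const (g y) using 1
    ext w
    simp [mul_smul]

lemma integrable_exp_smul_smulRight {W G : Type*} [NormedAddCommGroup W] [NormedSpace ℝ W]
    [NormedAddCommGroup G] [NormedSpace ℝ G]
    [IsFiniteMeasure μ] (hK : IsCompact K) (hμ : ∀ᵐ y ∂μ, y ∈ K)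
    {T : E → W →L[ℝ] ℝ} (hT : Continuous T) (θ : W) {g : E → G} (hg : Continuous g) :
    Integrable (fun y => Real.exp (T y θ) • (T y).smulRight (g y)) μ :=
  integrable_of_continuous_of_ae_mem_compact hK hμ
    ((Real.continuous_exp.comp (hT.clm_apply continuous_const)).smul
      ((ContinuousLinearMap.smulRightL ℝ W G).continuous₂.comp (hT.prodMk hg)))

lemma isProbabilityMeasure_tilted_of_compact [IsProbabilityMeasure μ] (hK : IsCompact K)
    (hμ : ∀ᵐ y ∂μ, y ∈ K) {f : E → ℝ} (hf : Continuous f) :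
    IsProbabilityMeasure (μ.tilted f) :=
  isProbabilityMeasure_tilted
    (integrable_of_continuous_of_ae_mem_compact hK hμ (Real.continuous_exp.comp hf))

/-- The derivative of the mean of an exponential family in its parameter is the covariance of the
sufficient statistic `T` with the identity. -/
lemma hasFDerivAt_integral_tilted {W : Type*} [NormedAddCommGroup W] [NormedSpace ℝ W]
    [NormedSpace ℝ E] [CompleteSpace E]
    [IsProbabilityMeasure μ] (hK : IsCompact K) (hμ : ∀ᵐ y ∂μ, y ∈ K)
    {T : E → W →L[ℝ] ℝ} (hT : Continuous T) (θ : W) :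
    HasFDerivAt (fun η => ∫ y, y ∂μ.tilted (fun y => T y η))
      (∫ y, (T y).smulRight (y - ∫ z, z ∂μ.tilted (fun y => T y θ)) ∂μ.tilted (fun y => T y θ))
      θ := by
  have hTη : ∀ η, Continuous fun y => T y η := fun η => hT.clm_apply continuous_const
  have hint : Integrable (fun y => Real.exp (T y θ)) μ :=
    integrable_of_continuous_of_ae_mem_compact hK hμ (Real.continuous_exp.comp (hTη θ))
  have hZ0 : (∫ y, Real.exp (T y θ) ∂μ) ≠ 0 := (integral_exp_pos hint).ne'
  have hZ := hasFDerivAt_integral_exp_smul hK hμ hT (g := fun _ => (1 : ℝ)) continuous_const θ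
  have hN := hasFDerivAt_integral_exp_smul hK hμ hT (g := fun y : E => y) continuous_id θ
  simp only [smul_eq_mul, mul_one] at hZ
  have hfun : (fun η => ∫ y, y ∂μ.tilted (fun y => T y η)) =
      fun η => (∫ y, Real.exp (T y η) ∂μ)⁻¹ • ∫ y, Real.exp (T y η) • y ∂μ := by
    funext η
    rw [integral_tilted, ← integral_smul]
    simp only [div_eq_inv_mul, mul_smul]
  set m := ∫ z, z ∂μ.tilted (fun y => T y θ) with hm
  have hmN : ∫ y, Real.exp (T y θ) • y ∂μ = (∫ y, Real.exp (T y θ) ∂μ) • m := by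
    rw [hm, congrFun hfun θ, smul_inv_smul₀ hZ0]
  rw [hfun]
  convert! ((hasDerivAt_inv hZ0).comp_hasFDerivAt θ hZ).smul hN using 1
  have hi := integrable_exp_smul_smulRight hK hμ hT θ (g := fun y => y) continuous_id
  have hi1 := integrable_exp_smul_smulRight hK hμ hT θ (g := fun _ => (1 : ℝ)) continuous_const
  ext w
  rw [integral_tilted]
  simp only [div_eq_inv_mul, mul_smul]
  rw [integral_smul, hmN]
  have e1 : (∫ y, Real.exp (T y θ) • (T y).smulRight (y - m) ∂μ) w
      = (∫ y, Real.exp (T y θ) • (T y).smulRight y ∂μ) w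
        - ((∫ y, Real.exp (T y θ) • (T y).smulRight (1 : ℝ) ∂μ) w) • m := by
    rw [ContinuousLinearMap.integral_apply (integrable_exp_smul_smulRight hK hμ hT θ
        (g := fun y => y - m) (continuous_id.sub continuous_const)),
      ContinuousLinearMap.integral_apply hi, ContinuousLinearMap.integral_apply hi1,
      ← integral_smul_const, ← integral_sub]
    · simp [smul_sub, mul_smul]
    · exact hi.apply_continuousLinearMap w
    · exact (hi1.apply_continuousLinearMap w).smul_const m
  simp only [smul_apply, add_apply, e1,
    ContinuousLinearMap.smulRight_apply, neg_apply, smul_sub, smul_smul,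
    neg_smul, smul_eq_mul]
  rw [sub_eq_add_neg, ← neg_smul]
  congr 2
  field_simp

lemma norm_sub_integral_le_diam [NormedSpace ℝ E] [CompleteSpace E] [IsProbabilityMeasure μ]
    (hK : IsCompact K) (hμ : ∀ᵐ y ∂μ, y ∈ K) {y : E} (hy : y ∈ K) :
    ‖y - ∫ z, z ∂μ‖ ≤ Metric.diam K := by
  have hint : Integrable (fun z => z) μ :=
    integrable_of_continuous_of_ae_mem_compact hK hμ continuous_id
  -- An average of the differences `y - z`, each of norm at most the diameter.
  have h : y - ∫ z, z ∂μ = ∫ z, (y - z) ∂μ := by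
    rw [integral_sub (integrable_const y) hint]
    simp
  rw [h]
  simpa using norm_integral_le_of_norm_le_const (μ := μ) (hμ.mono fun z hz =>
    (dist_eq_norm y z).symm.trans_le (Metric.dist_le_diam_of_mem hK.isBounded hy hz))

/-- A covariance is unchanged when a constant `c` is subtracted from the first variable, so it is
bounded by the oscillation of that variable about `c` times the diameter of the support. -/
lemma norm_integral_smulRight_sub_mean_le {W : Type*} [NormedAddCommGroup W] [NormedSpace ℝ W]
    [NormedSpace ℝ E] [CompleteSpace E] [IsProbabilityMeasure μ] (hK : IsCompact K)
    (hμ : ∀ᵐ y ∂μ, y ∈ K) {T : E → W →L[ℝ] ℝ} (hT : Continuous T) (w : W) {c M : ℝ}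
    (hc : ∀ y ∈ K, |T y w - c| ≤ M) :
    ‖(∫ y, (T y).smulRight (y - ∫ z, z ∂μ) ∂μ) w‖ ≤ M * Metric.diam K := by
  have hsub : Continuous fun y : E => y - ∫ z, z ∂μ := continuous_id.sub continuous_const
  have hint : Integrable (fun y => (T y).smulRight (y - ∫ z, z ∂μ)) μ :=
    integrable_of_continuous_of_ae_mem_compact hK hμ
      ((ContinuousLinearMap.smulRightL ℝ W E).continuous₂.comp (hT.prodMk hsub))
  have hzero : ∫ y, c • (y - ∫ z, z ∂μ) ∂μ = 0 := by
    rw [integral_smul, integral_sub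
      (integrable_of_continuous_of_ae_mem_compact hK hμ continuous_id') (integrable_const _)]
    simp
  have heq : (∫ y, (T y).smulRight (y - ∫ z, z ∂μ) ∂μ) w
      = ∫ y, (T y w - c) • (y - ∫ z, z ∂μ) ∂μ := by
    rw [ContinuousLinearMap.integral_apply hint]
    simp only [sub_smul]
    rw [integral_sub, hzero, sub_zero]
    · rfl
    · exact hint.apply_continuousLinearMap w
    · exact integrable_of_continuous_of_ae_mem_compact hK hμ (hsub.const_smul c)
  rw [heq]
  simpa using norm_integral_le_of_norm_le_const (μ := μ) (hμ.mono fun y hy =>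
    (norm_smul_le (T y w - c) (y - ∫ z, z ∂μ)).trans
      (mul_le_mul (hc y hy) (norm_sub_integral_le_diam hK hμ hy) (norm_nonneg _)
        ((abs_nonneg _).trans (hc y hy))))

end Tilting

/-! ### The velocity as a posterior mean -/

section Velocity

variable {d : ℕ} {ν : Measure (Space d)}

/-- The sufficient statistic `y ↦ (y, ‖y‖²)`, as the linear functional
`(ξ, b) ↦ ⟪y, ξ⟫ + b ‖y‖²` of the natural parameter `(ξ, b)`. -/
noncomputable def statistic (y : Space d) : Space d × ℝ →L[ℝ] ℝ :=
  (innerSL ℝ y).coprod (‖y‖ ^ 2 • ContinuousLinearMap.id ℝ ℝ)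

lemma statistic_apply (y : Space d) (θ : Space d × ℝ) :
    statistic y θ = ⟪y, θ.1⟫ + ‖y‖ ^ 2 * θ.2 := by
  simp [statistic]

lemma continuous_statistic : Continuous (statistic : Space d → Space d × ℝ →L[ℝ] ℝ) := by
  have h : (statistic : Space d → Space d × ℝ →L[ℝ] ℝ) = fun y =>
      (innerSL ℝ y).comp (ContinuousLinearMap.fst ℝ (Space d) ℝ)
        + ‖y‖ ^ 2 • ContinuousLinearMap.snd ℝ (Space d) ℝ := by
    funext y
    ext θ <;> simp [statistic]
  rw [h]
  exact (((innerSL ℝ).continuous).clm_comp continuous_const).add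
    ((continuous_norm.pow 2).smul continuous_const)

/-- The natural parameter of the conditional law of the data point `Y ∼ ν` given that the process
is at `x` at time `t`. The second component absorbs the `y`-dependent factor
`exp (-t² ‖y‖² / (2 (1 - t²)))` of the Gaussian kernel, so that the base measure is `ν` itself. -/
noncomputable def naturalParam (t : ℝ) (x : Space d) : Space d × ℝ :=
  ((t / (1 - t ^ 2)) • x, -t ^ 2 / (2 * (1 - t ^ 2)))

lemma hasFDerivAt_naturalParam (t : ℝ) (x : Space d) :
    HasFDerivAt (fun z : Space d => naturalParam t z)
      (((t / (1 - t ^ 2)) • ContinuousLinearMap.id ℝ (Space d)).prod 0) x := by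
  have h := ((hasFDerivAt_id (𝕜 := ℝ) x).const_smul (t / (1 - t ^ 2))).prodMk
    (hasFDerivAt_const (𝕜 := ℝ) (-t ^ 2 / (2 * (1 - t ^ 2))) x)
  exact h

/-- The conditional law of the data point `Y ∼ ν` given that the process is at `x` at time `t`. -/
noncomputable def posterior (ν : Measure (Space d)) (t : ℝ) (x : Space d) : Measure (Space d) :=
  ν.tilted fun y => statistic y (naturalParam t x)

/-- The normalizing constant of the posterior is, up to a Gaussian factor, the forward density. -/
lemma forwardDensity_eq {t : ℝ} (ht : 0 < 1 - t ^ 2) (x : Space d) :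
    forwardDensity ν (1 - t) x = (2 * Real.pi * (1 - t ^ 2)) ^ (-(d : ℝ) / 2) *
      (Real.exp (-‖x‖ ^ 2 / (2 * (1 - t ^ 2))) *
        ∫ y, Real.exp (statistic y (naturalParam t x)) ∂ν) := by
  have hs : (1 - t) * (2 - (1 - t)) = 1 - t ^ 2 := by ring
  unfold forwardDensity gaussianDensity
  rw [hs, ← integral_const_mul, ← integral_const_mul]
  refine integral_congr_ae (Eventually.of_forall fun y => ?_)
  simp only
  rw [← Real.exp_add, statistic_apply, sub_sub_cancel, norm_sub_sq_real, norm_smul, mul_pow,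
    Real.norm_eq_abs, sq_abs]
  simp only [naturalParam, inner_smul_right, real_inner_comm x y]
  congr 2
  field_simp
  ring

/-- Tweedie's formula: the score is an affine function of the posterior mean. -/
lemma score_eq [IsProbabilityMeasure ν] (hK : IsCompact ν.support) {t : ℝ} (ht : 0 < 1 - t ^ 2)
    (x : Space d) :
    score ν t x = (1 / (1 - t ^ 2)) • (t • (∫ y, y ∂posterior ν t x) - x) := by
  have hν : ∀ᵐ y ∂ν, y ∈ ν.support := Measure.support_mem_ae
  set Z : Space d × ℝ → ℝ := fun θ => ∫ y, Real.exp (statistic y θ) ∂ν with hZdef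
  have hZpos : ∀ θ, 0 < Z θ := fun θ => integral_exp_pos
    (integrable_of_continuous_of_ae_mem_compact hK hν
      (Real.continuous_exp.comp (continuous_statistic.clm_apply continuous_const)))
  have hZ := hasFDerivAt_integral_exp_smul hK hν continuous_statistic
    (g := fun _ => (1 : ℝ)) continuous_const (naturalParam t x)
  simp only [smul_eq_mul, mul_one] at hZ
  have hθ := hasFDerivAt_naturalParam t x
  have hlog : (fun z => Real.log (forwardDensity ν (1 - t) z)) = fun z =>
      Real.log ((2 * Real.pi * (1 - t ^ 2)) ^ (-(d : ℝ) / 2)) +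
        (-‖z‖ ^ 2 / (2 * (1 - t ^ 2)) + Real.log (Z (naturalParam t z))) := by
    funext z
    have h1 : (0 : ℝ) < (2 * Real.pi * (1 - t ^ 2)) ^ (-(d : ℝ) / 2) :=
      Real.rpow_pos_of_pos (by positivity) _
    rw [forwardDensity_eq ht, Real.log_mul h1.ne' (mul_pos (Real.exp_pos _) (hZpos _)).ne',
      Real.log_mul (Real.exp_pos _).ne' (hZpos _).ne', Real.log_exp]
  have hd := ((((hasStrictFDerivAt_norm_sq x).hasFDerivAt.neg.mul_const
    (2 * (1 - t ^ 2))⁻¹).add ((hZ.comp x hθ).log (hZpos _).ne'))).const_add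
      (Real.log ((2 * Real.pi * (1 - t ^ 2)) ^ (-(d : ℝ) / 2)))
  unfold score
  apply HasGradientAt.gradient
  rw [hasGradientAt_iff_hasFDerivAt, hlog]
  convert! hd using 1
  ext w
  have hint := integrable_exp_smul_smulRight hK hν continuous_statistic (naturalParam t x)
    (g := fun _ => (1 : ℝ)) continuous_const
  have hint' : Integrable (fun y : Space d => Real.exp (statistic y (naturalParam t x)) • y) ν :=
    integrable_of_continuous_of_ae_mem_compact hK hν ((Real.continuous_exp.comp
      (continuous_statistic.clm_apply continuous_const)).smul continuous_id')
  have hmean : ⟪∫ y, y ∂posterior ν t x, w⟫ = (Z (naturalParam t x))⁻¹ *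
      ∫ y, Real.exp (statistic y (naturalParam t x)) * ⟪y, w⟫ ∂ν := by
    have h1 : ∫ y, y ∂posterior ν t x = (Z (naturalParam t x))⁻¹ •
        ∫ y, Real.exp (statistic y (naturalParam t x)) • y ∂ν := by
      rw [posterior, integral_tilted, ← integral_smul]
      simp only [div_eq_inv_mul, mul_smul, hZdef]
    rw [h1, inner_smul_left, real_inner_comm, ← integral_inner hint']
    simp [inner_smul_right, real_inner_comm w]
  have hZw : (∫ y, Real.exp (statistic y (naturalParam t x)) • (statistic y).smulRight (1 : ℝ) ∂ν)
      ((t / (1 - t ^ 2)) • w, 0) = t / (1 - t ^ 2) *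
        ∫ y, Real.exp (statistic y (naturalParam t x)) * ⟪y, w⟫ ∂ν := by
    rw [ContinuousLinearMap.integral_apply hint, ← integral_const_mul]
    refine integral_congr_ae (Eventually.of_forall fun y => ?_)
    simp [statistic_apply, inner_smul_right]
    ring
  simp
  rw [hmean, hZw]
  simp only [hZdef]
  ring

/-- In terms of the posterior, the velocity is smooth at `t = 0`: the factor `1 / t` cancels. -/
lemma velocity_eq [IsProbabilityMeasure ν] (hK : IsCompact ν.support) {t : ℝ}
    (ht : 0 < 1 - t ^ 2) (x : Space d) :
    velocity ν t x = (1 - t ^ 2)⁻¹ • ((∫ y, y ∂posterior ν t x) - t • x) := by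
  unfold velocity
  split_ifs with h
  · subst h
    have : (fun y : Space d => statistic y (naturalParam 0 x)) = fun _ => 0 := by
      funext y
      simp [naturalParam, statistic_apply]
    simp [posterior, this]
  · rw [score_eq hK ht]
    match_scalars <;> field_simp
    ring

lemma isProbabilityMeasure_posterior [IsProbabilityMeasure ν] (hK : IsCompact ν.support) (t : ℝ)
    (x : Space d) : IsProbabilityMeasure (posterior ν t x) :=
  isProbabilityMeasure_tilted_of_compact hK Measure.support_mem_ae
    (continuous_statistic.clm_apply continuous_const)

lemma ae_posterior_mem_support (t : ℝ) (x : Space d) :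
    ∀ᵐ y ∂posterior ν t x, y ∈ ν.support :=
  (tilted_absolutelyContinuous ν _).ae_le Measure.support_mem_ae

/-! ### Derivatives and bounds of the velocity -/

lemma norm_posterior_mean_le [IsProbabilityMeasure ν] (hK : IsCompact ν.support) {R : ℝ}
    (hsub : ν.support ⊆ Metric.closedBall 0 R) (t : ℝ) (x : Space d) :
    ‖∫ y, y ∂posterior ν t x‖ ≤ R := by
  have := isProbabilityMeasure_posterior hK t x
  simpa using norm_integral_le_of_norm_le_const (μ := posterior ν t x)
    ((ae_posterior_mem_support t x).mono fun y hy => mem_closedBall_zero_iff.1 (hsub hy))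

/-- The derivative of the mean of the posterior in its natural parameter: the posterior covariance
of the sufficient statistic with the data point. -/
noncomputable def posteriorCov (ν : Measure (Space d)) (t : ℝ) (x : Space d) :
    Space d × ℝ →L[ℝ] Space d :=
  ∫ y, (statistic y).smulRight (y - ∫ z, z ∂posterior ν t x) ∂posterior ν t x

lemma hasFDerivAt_velocity [IsProbabilityMeasure ν] (hK : IsCompact ν.support) {t : ℝ}
    (ht : 0 < 1 - t ^ 2) (x : Space d) :
    HasFDerivAt (velocity ν t) ((1 - t ^ 2)⁻¹ • ((posteriorCov ν t x).comp
      (((t / (1 - t ^ 2)) • ContinuousLinearMap.id ℝ (Space d)).prod 0)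
        - t • ContinuousLinearMap.id ℝ (Space d))) x := by
  have hm := (hasFDerivAt_integral_tilted hK Measure.support_mem_ae continuous_statistic
    (naturalParam t x)).comp x (hasFDerivAt_naturalParam t x)
  have h := (hm.sub ((hasFDerivAt_id (𝕜 := ℝ) x).const_smul t)).const_smul ((1 - t ^ 2)⁻¹)
  rw [show velocity ν t = fun z => (1 - t ^ 2)⁻¹ • ((∫ y, y ∂posterior ν t z) - t • z) from
    funext fun z => velocity_eq hK ht z]
  exact h

lemma hasDerivAt_naturalParam {t : ℝ} (ht : 0 < 1 - t ^ 2) (x : Space d) :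
    HasDerivAt (fun s => naturalParam s x)
      (((1 + t ^ 2) / (1 - t ^ 2) ^ 2) • x, -t / (1 - t ^ 2) ^ 2) t := by
  have hv : HasDerivAt (fun s : ℝ => 1 - s ^ 2) (-(2 * t)) t := by
    simpa using (hasDerivAt_pow 2 t).const_sub 1
  have h1 : HasDerivAt (fun s : ℝ => s / (1 - s ^ 2)) ((1 + t ^ 2) / (1 - t ^ 2) ^ 2) t := by
    convert! (hasDerivAt_id t).div hv ht.ne' using 1
    simp only [id]
    ring
  have h2 : HasDerivAt (fun s : ℝ => -s ^ 2 / (2 * (1 - s ^ 2))) (-t / (1 - t ^ 2) ^ 2) t := by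
    convert! (hasDerivAt_pow 2 t).neg.div (hv.const_mul 2) (mul_pos two_pos ht).ne' using 1
    simp
    field_simp
    ring
  exact (h1.smul_const x).prodMk h2

lemma hasDerivWithinAt_velocity [IsProbabilityMeasure ν] (hK : IsCompact ν.support) {t : ℝ}
    (ht : 0 < 1 - t ^ 2) (x : Space d) (S : Set ℝ) :
    HasDerivWithinAt (fun s => velocity ν s x)
      ((1 - t ^ 2)⁻¹ • (posteriorCov ν t x
          (((1 + t ^ 2) / (1 - t ^ 2) ^ 2) • x, -t / (1 - t ^ 2) ^ 2) - x) +
        (2 * t / (1 - t ^ 2) ^ 2) • ((∫ y, y ∂posterior ν t x) - t • x)) S t := by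
  have hm : HasDerivAt (fun s => ∫ y, y ∂posterior ν s x) (posteriorCov ν t x
      (((1 + t ^ 2) / (1 - t ^ 2) ^ 2) • x, -t / (1 - t ^ 2) ^ 2)) t := by
    have h := (hasFDerivAt_integral_tilted hK Measure.support_mem_ae continuous_statistic
      (naturalParam t x)).comp_hasDerivAt t (hasDerivAt_naturalParam ht x)
    exact h
  have hv : HasDerivAt (fun s : ℝ => 1 - s ^ 2) (-(2 * t)) t := by
    simpa using (hasDerivAt_pow 2 t).const_sub 1
  have h := (hv.fun_inv ht.ne').smul (hm.sub ((hasDerivAt_id t).smul_const x))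
  have hev : (fun s => velocity ν s x) =ᶠ[𝓝 t]
      fun s => (1 - s ^ 2)⁻¹ • ((∫ y, y ∂posterior ν s x) - s • x) := by
    have hc : Continuous fun s : ℝ => 1 - s ^ 2 := by fun_prop
    filter_upwards [hc.continuousAt.eventually (lt_mem_nhds ht)] with s hs
    exact velocity_eq hK hs x
  refine (HasDerivAt.congr_of_eventuallyEq ?_ hev).hasDerivWithinAt
  convert! h using 1
  simp

lemma norm_posteriorCov_apply_le [IsProbabilityMeasure ν] (hK : IsCompact ν.support) (t : ℝ)
    (x : Space d) (w : Space d × ℝ) {c M : ℝ} (hc : ∀ y ∈ ν.support, |statistic y w - c| ≤ M) :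
    ‖posteriorCov ν t x w‖ ≤ M * Metric.diam ν.support := by
  have := isProbabilityMeasure_posterior hK t x
  exact norm_integral_smulRight_sub_mean_le hK (ae_posterior_mem_support t x)
    continuous_statistic w hc

/-- In a spatial direction `w` the sufficient statistic is `⟪y, w⟫`, which on the support
oscillates about its posterior mean by at most `‖w‖` times the diameter. -/
lemma norm_posteriorCov_space_le [IsProbabilityMeasure ν] (hK : IsCompact ν.support)
    (t : ℝ) (x w : Space d) :
    ‖posteriorCov ν t x (w, 0)‖ ≤ Metric.diam ν.support ^ 2 * ‖w‖ := by
  have := isProbabilityMeasure_posterior hK t x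
  have h := norm_posteriorCov_apply_le hK t x (w, 0) (c := ⟪∫ z, z ∂posterior ν t x, w⟫)
    (M := Metric.diam ν.support * ‖w‖) fun y hy => by
      rw [statistic_apply]
      simp only [mul_zero, add_zero]
      rw [← inner_sub_left]
      exact (abs_real_inner_le_norm _ _).trans (mul_le_mul_of_nonneg_right
        (norm_sub_integral_le_diam hK (ae_posterior_mem_support t x) hy) (norm_nonneg _))
  linarith

/-- In the quadratic direction the sufficient statistic is `‖y‖²`, which lies in `[0, R²]`. -/
lemma norm_posteriorCov_quadratic_le [IsProbabilityMeasure ν] (hK : IsCompact ν.support) {R : ℝ}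
    (hsub : ν.support ⊆ Metric.closedBall 0 R) (t : ℝ) (x : Space d) (b : ℝ) :
    ‖posteriorCov ν t x (0, b)‖ ≤ R ^ 2 * |b| * Metric.diam ν.support := by
  refine norm_posteriorCov_apply_le hK t x (0, b) (c := 0) fun y hy => ?_
  have hy' : ‖y‖ ≤ R := mem_closedBall_zero_iff.1 (hsub hy)
  rw [statistic_apply]
  simp only [inner_zero_right, zero_add, sub_zero, abs_mul, abs_pow, abs_norm]
  gcongr

lemma norm_fderiv_velocity_le [IsProbabilityMeasure ν] (hK : IsCompact ν.support) {t : ℝ}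
    (ht0 : 0 ≤ t) (ht : 0 < 1 - t ^ 2) (x : Space d) :
    ‖fderiv ℝ (velocity ν t) x‖ ≤
      (Metric.diam ν.support ^ 2 / (1 - t ^ 2) ^ 2 + 1 / (1 - t ^ 2)) * t := by
  rw [(hasFDerivAt_velocity hK ht x).fderiv]
  refine ContinuousLinearMap.opNorm_le_bound _ (by positivity) fun w => ?_
  have h := norm_posteriorCov_space_le hK t x ((t / (1 - t ^ 2)) • w)
  rw [norm_smul, Real.norm_of_nonneg (by positivity)] at h
  calc _ = ‖(1 - t ^ 2)⁻¹ • (posteriorCov ν t x ((t / (1 - t ^ 2)) • w, 0) - t • w)‖ := by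
        simp
    _ ≤ (1 - t ^ 2)⁻¹ * (Metric.diam ν.support ^ 2 * (t / (1 - t ^ 2) * ‖w‖) + t * ‖w‖) := by
        rw [norm_smul, Real.norm_of_nonneg (by positivity)]
        gcongr
        refine (norm_sub_le _ _).trans (add_le_add h ?_)
        rw [norm_smul, Real.norm_of_nonneg ht0]
    _ = _ := by field_simp

lemma norm_velocity_le [IsProbabilityMeasure ν] (hK : IsCompact ν.support) {R : ℝ}
    (hsub : ν.support ⊆ Metric.closedBall 0 R) {t : ℝ} (ht0 : 0 ≤ t) (ht : 0 < 1 - t ^ 2)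
    (x : Space d) :
    ‖velocity ν t x‖ ≤ (R + t * ‖x‖) / (1 - t ^ 2) := by
  rw [velocity_eq hK ht, norm_smul, Real.norm_of_nonneg (by positivity), inv_mul_eq_div]
  gcongr
  refine (norm_sub_le _ _).trans (add_le_add (norm_posterior_mean_le hK hsub t x) ?_)
  rw [norm_smul, Real.norm_of_nonneg ht0]

lemma norm_derivWithin_velocity_le [IsProbabilityMeasure ν] (hK : IsCompact ν.support) {R : ℝ}
    (hdiam : Metric.diam ν.support ≤ R) (hsub : ν.support ⊆ Metric.closedBall 0 R) {t : ℝ}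
    (ht0 : 0 ≤ t) (ht : 0 < 1 - t ^ 2) (x : Space d) {S : Set ℝ}
    (hS : UniqueDiffWithinAt ℝ S t) :
    ‖derivWithin (fun s => velocity ν s x) S t‖ ≤
      ((1 + t ^ 2) * R ^ 2 / (1 - t ^ 2) ^ 3 + 2 * t ^ 2 / (1 - t ^ 2) ^ 2 + 1 / (1 - t ^ 2)) * ‖x‖
        + t * R ^ 3 / (1 - t ^ 2) ^ 3 + 2 * t * R / (1 - t ^ 2) ^ 2 := by
  rw [(hasDerivWithinAt_velocity hK ht x S).derivWithin hS]
  have hD : 0 ≤ Metric.diam ν.support := Metric.diam_nonneg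
  have hR : 0 ≤ R := hD.trans hdiam
  have h1 : ‖posteriorCov ν t x (((1 + t ^ 2) / (1 - t ^ 2) ^ 2) • x, 0)‖ ≤
      R ^ 2 * ((1 + t ^ 2) / (1 - t ^ 2) ^ 2 * ‖x‖) := by
    refine (norm_posteriorCov_space_le hK t x _).trans ?_
    rw [norm_smul, Real.norm_of_nonneg (by positivity)]
    gcongr
  have h2 : ‖posteriorCov ν t x (0, -t / (1 - t ^ 2) ^ 2)‖ ≤
      R ^ 2 * (t / (1 - t ^ 2) ^ 2) * R := by
    refine (norm_posteriorCov_quadratic_le hK hsub t x _).trans ?_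
    rw [neg_div, abs_neg, abs_of_nonneg (by positivity)]
    gcongr
  have h3 : posteriorCov ν t x (((1 + t ^ 2) / (1 - t ^ 2) ^ 2) • x, -t / (1 - t ^ 2) ^ 2) =
      posteriorCov ν t x (((1 + t ^ 2) / (1 - t ^ 2) ^ 2) • x, 0) +
        posteriorCov ν t x (0, -t / (1 - t ^ 2) ^ 2) := by
    rw [← map_add, Prod.mk_add_mk, add_zero, zero_add]
  have h4 : ‖(∫ y, y ∂posterior ν t x) - t • x‖ ≤ R + t * ‖x‖ := by
    refine (norm_sub_le _ _).trans (add_le_add (norm_posterior_mean_le hK hsub t x) ?_)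
    rw [norm_smul, Real.norm_of_nonneg ht0]
  calc _ ≤ (1 - t ^ 2)⁻¹ * (R ^ 2 * ((1 + t ^ 2) / (1 - t ^ 2) ^ 2 * ‖x‖) +
          R ^ 2 * (t / (1 - t ^ 2) ^ 2) * R + ‖x‖) +
        (2 * t / (1 - t ^ 2) ^ 2) * (R + t * ‖x‖) := by
        refine (norm_add_le _ _).trans ?_
        rw [norm_smul, norm_smul, Real.norm_of_nonneg (by positivity : 0 ≤ (1 - t ^ 2)⁻¹),
          Real.norm_of_nonneg (by positivity : 0 ≤ 2 * t / (1 - t ^ 2) ^ 2), h3]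
        gcongr
        exact (norm_sub_le _ _).trans
          (add_le_add ((norm_add_le _ _).trans (add_le_add h1 h2)) le_rfl)
    _ = _ := by field_simp; ring

end Velocity

/-! ### The constants -/

section Constants

variable {δ t : ℝ}

lemma sigmaSq_pos (hδ0 : 0 < δ) (hδ1 : δ < 1) : 0 < sigmaSq δ := by
  unfold sigmaSq
  nlinarith

lemma sigmaSq_le (ht : t ∈ Set.Icc 0 (1 - δ)) : sigmaSq δ ≤ 1 - t ^ 2 := by
  have := pow_le_pow_left₀ ht.1 ht.2 2
  unfold sigmaSq
  linarith

lemma le_C1 (hδ0 : 0 < δ) (hδ1 : δ < 1) (H : ℝ) : (1 + (1 - δ) ^ 2) / sigmaSq δ ≤ C1 δ H := by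
  refine le_trans (le_of_eq ?_) ((le_max_right _ _).trans (le_max_left _ _))
  rw [abs_of_pos (sigmaSq_pos hδ0 hδ1), abs_of_nonpos (by nlinarith [sq_nonneg (1 - δ)])]
  ring

lemma two_le_C2 (δ H : ℝ) : 2 ≤ C2 δ H :=
  (le_max_left _ _).trans (le_max_left _ _)

end Constants

end Follmer

theorem corollary3p16 {d : ℕ} (ν : MeasureTheory.Measure (Follmer.Space d))
    [MeasureTheory.IsProbabilityMeasure ν] (R δ : ℝ) (hR : 0 < R)
    (hδ0 : 0 < δ) (hδ1 : δ < 1)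
    (hcompact : IsCompact ν.support) (hdiam : Metric.diam ν.support ≤ R) :
    (∀ t ∈ Set.Icc (0 : ℝ) (1 - δ), ∀ x : Follmer.Space d,
      DifferentiableAt ℝ (Follmer.velocity ν t) x ∧
      ‖fderiv ℝ (Follmer.velocity ν t) x‖ ≤ (Follmer.K1 R δ + Follmer.K2 δ) * t ∧
      DifferentiableWithinAt ℝ (fun s => Follmer.velocity ν s x) (Set.Icc 0 1) t) ∧
    (ν.support ⊆ Metric.closedBall 0 R →
      ∀ t ∈ Set.Icc (0 : ℝ) (1 - δ), ∀ x : Follmer.Space d,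
        ‖Follmer.velocity ν t x‖ ≤ Follmer.K0 R δ + Follmer.K2 δ * t * ‖x‖ ∧
        ‖derivWithin (fun s => Follmer.velocity ν s x) (Set.Icc 0 1) t‖ ≤
          Follmer.K5 R δ (Follmer.hessianSup ν δ) * ‖x‖ +
            Follmer.K6 R δ (Follmer.hessianSup ν δ) / Real.sqrt (1 - t ^ 2) +
            Follmer.K7 R δ (Follmer.hessianSup ν δ)) := by
  have hσ := Follmer.sigmaSq_pos hδ0 hδ1
  refine ⟨fun t ht x => ?_, fun hsub t ht x => ?_⟩
  · have hv := Follmer.sigmaSq_le ht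
    have hv0 := hσ.trans_le hv
    have ht0 := ht.1
    refine ⟨(Follmer.hasFDerivAt_velocity hcompact hv0 x).differentiableAt, ?_,
      (Follmer.hasDerivWithinAt_velocity hcompact hv0 x _).differentiableWithinAt⟩
    calc _ ≤ (Metric.diam ν.support ^ 2 / (1 - t ^ 2) ^ 2 + 1 / (1 - t ^ 2)) * t :=
          Follmer.norm_fderiv_velocity_le hcompact ht0 hv0 x
      _ ≤ (R ^ 2 / Follmer.sigmaSq δ ^ 2 + 1 / Follmer.sigmaSq δ) * t := by gcongr
      _ ≤ (Follmer.K1 R δ + Follmer.K2 δ) * t := by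
          unfold Follmer.K1 Follmer.K2
          rw [← div_pow]
          gcongr
          nlinarith [sq_nonneg (R / Follmer.sigmaSq δ)]
  · have hv := Follmer.sigmaSq_le ht
    have hv0 := hσ.trans_le hv
    have ht0 := ht.1
    have ht1 : t ≤ 1 := ht.2.trans (by linarith)
    constructor
    · calc _ ≤ (R + t * ‖x‖) / (1 - t ^ 2) := Follmer.norm_velocity_le hcompact hsub ht0 hv0 x
        _ ≤ (R + t * ‖x‖) / Follmer.sigmaSq δ := by gcongr
        _ = _ := by
          unfold Follmer.K0 Follmer.K2
          ring
    · set H := Follmer.hessianSup ν δ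
      set s := Follmer.sigmaSq δ
      have hC1 := Follmer.le_C1 hδ0 hδ1 H
      have hC2 := Follmer.two_le_C2 δ H
      have hC1' : 0 ≤ Follmer.C1 δ H := le_trans (by positivity) hC1
      -- The coefficient of `‖x‖`, with `1 / v ≤ 1 / σ²`.
      have hx : (1 + t ^ 2) * R ^ 2 / (1 - t ^ 2) ^ 3 + 2 * t ^ 2 / (1 - t ^ 2) ^ 2 +
          1 / (1 - t ^ 2) ≤ Follmer.K5 R δ H := by
        calc _ ≤ (1 + (1 - δ) ^ 2) * R ^ 2 / s ^ 3 + 2 * 1 ^ 2 / s ^ 2 + 1 / s := by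
              gcongr
              exact ht.2
          _ = (1 + (1 - δ) ^ 2) / s * (R ^ 2 / s ^ 2) + 2 / s ^ 2 + 1 / s := by
              field_simp
          _ ≤ 9 * Follmer.C1 δ H * (R ^ 2 / s ^ 2) + 2 / s ^ 2 + 1 / s := by
              gcongr
              linarith
          _ = Follmer.K5 R δ H := by
              unfold Follmer.K5
              ring
      -- The terms without `x` already fit below `K₇`, so that `K₆` only has to be nonnegative.
      have hc : t * R ^ 3 / (1 - t ^ 2) ^ 3 + 2 * t * R / (1 - t ^ 2) ^ 2 ≤ Follmer.K7 R δ H := by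
        calc _ ≤ 1 * R ^ 3 / s ^ 3 + 2 * 1 * R / s ^ 2 := by gcongr
          _ = 1 * (R / s) ^ 3 * 1 + 2 * R / s ^ 2 := by
              rw [div_pow]
              ring
          _ ≤ 6 * (Real.sqrt 3 + 1) * (R / s) ^ 3 * Follmer.C2 δ H + 2 * R / s ^ 2 := by
              gcongr
              · linarith [Real.sqrt_nonneg 3]
              · linarith
      have h6 : 0 ≤ Follmer.K6 R δ H / Real.sqrt (1 - t ^ 2) := by
        have : 0 ≤ Follmer.C2 δ H := by linarith
        unfold Follmer.K6
        positivity
      have hmain := Follmer.norm_derivWithin_velocity_le hcompact hdiam hsub ht0 hv0 x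
        ((uniqueDiffOn_Icc zero_lt_one) t ⟨ht0, ht1⟩)
      have := mul_le_mul_of_nonneg_right hx (norm_nonneg x)
      linarith
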